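/- Indices are taken cyclically in $\{1,2,3,4\}$. Let $f_1,\dots,f_4:\mathbb{R}\to\mathbb{R}$ be differentiable functions with $f_i'(t)=a_it+b_i$ ($a_i,b_i\in\mathbb{R}$), and let $p_i$ be a critical point of $f_{i+1}-f_i$. Assume that one of the following conditions holds (where $(a,b)$ is the open interval, empty if $a\ge b$): 1. $a_2,a_4\in(a_1,a_3)$, and $p_4<p_1<p_2<p_3$ or $p_3<p_2<p_1<p_4$; 2. $a_2,a_4\in(a_3,a_1)$, and $p_1<p_4<p_3<p_2$ or $p_2<p_3<p_4<p_1$; 3. $a_1,a_3\in(a_2,a_4)$, and $p_1<p_2<p_3<p_4$ or $p_4<p_3<p_2<p_1$; 4. $a_1,a_3\in(a_4,a_2)$, and $p_3<p_4<p_1<p_2$ or $p_2<p_1<p_4<p_3$; 5. $\max\{a_1,a_3\}<\min\{a_2,a_4\}$, and one of $p_4<p_1<p_3<p_2$, $p_2<p_3<p_1<p_4$, $p_4<p_3<p_1<p_2$, $p_2<p_1<p_3<p_4$, $p_4<p_1=p_3<p_2$, $p_2<p_3=p_1<p_4$; 6. $\max\{a_2,a_4\}<\min\{a_1,a_3\}$,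 and one of $p_1<p_4<p_2<p_3$, $p_3<p_2<p_4<p_1$, $p_3<p_4<p_2<p_1$, $p_1<p_2<p_4<p_3$, $p_1<p_4=p_2<p_3$, $p_3<p_2=p_4<p_1$. For $\epsilon>0$ put $L_i^\epsilon=\{x+iy\in\mathbb{C}\mid y=\epsilon f_i'(x)\}$ and let $x_i^\epsilon$ be the intersection point of $L_i^\epsilon$ and $L_{i+1}^\epsilon$; under the assumption above, $x_1^\epsilon,x_2^\epsilon,x_3^\epsilon,x_4^\epsilon$ are the vertices, in counterclockwise order, of a convex quadrilateral. Let $w_\epsilon$ be the Schwarz–Christoffel map from the upper half plane to this quadrilateral with $w_\epsilon(z_i)=x_i^\epsilon$ for $i=1,2,3$, where $z_1=1$, $z_2=\infty$, $z_3=0$; that is, the conformal map from the open upper half plane onto the interior of the quadrilateral, extended to a homeomorphism from the closed upper half plane with $\infty$ onto the closed quadrilateral, with these values. Let $z_{4,\epsilon}=w_\epsilon^{-1}(x_4^\epsilon)\in(0,1)$. Then $$\lim_{\epsilon\to+0}z_{4,\epsilon}=z_1=1\quad\text{if }(p_3-p_1)(p_4-p_2)<0,\qquad \lim_{\epsilon\to+0}z_{4,\epsilon}=z_3=0\quad\text{if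 }(p_3-p_1)(p_4-p_2)>0.$$ -/

import Mathlib

open Set Filter Topology

/-- The open upper half plane. -/
def openUpperHalfPlane : Set ℂ := {z | 0 < z.im}

/-- The closed upper half plane (without the point at infinity). -/
def closedUpperHalfPlane : Set ℂ := {z | 0 ≤ z.im}

/-- The graph of `ε df` in the cotangent bundle of the real line, which is identified with the
plane `ℝ² = ℂ`: base coordinate = real part, fibre coordinate = imaginary part. -/
def graphSection (ε : ℝ) (f : ℝ → ℝ) : Set ℂ := {z | z.im = ε * deriv f z.re}

/-- The interior of the convex quadrilateral with the vertices `x 0, x 1, x 2, x 3`. -/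
def quadInterior (x : Fin 4 → ℂ) : Set ℂ := interior (convexHull ℝ (range x))

/-- `w` is a Schwarz-Christoffel map from the upper half plane to the bounded polygonal domain `P`
with `w(∞) = v`: a conformal (holomorphic and bijective) map of the open half plane onto `P`,
together with its extension to a homeomorphism from the closed half plane, including `∞`, onto the
closure of `P`. -/
structure IsSchwarzChristoffel (w : ℂ → ℂ) (P : Set ℂ) (v : ℂ) : Prop where
  holomorphic : DifferentiableOn ℂ w openUpperHalfPlane
  bijOn : BijOn w openUpperHalfPlane P
  continuousOn : ContinuousOn w closedUpperHalfPlane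
  bijOn_closed : BijOn w closedUpperHalfPlane (closure P \ {v})
  tendsto_infty : Tendsto w (cocompact ℂ ⊓ 𝓟 closedUpperHalfPlane) (𝓝 v)

/-- The table of conditions on the slopes `a₁, …, a₄` and on the critical points `p₁, …, p₄`
under which the lines bound a convex quadrilateral with vertices in counterclockwise order. -/
def QuadTable (a₁ a₂ a₃ a₄ p₁ p₂ p₃ p₄ : ℝ) : Prop :=
  ((a₂ ∈ Ioo a₁ a₃ ∧ a₄ ∈ Ioo a₁ a₃) ∧
    ((p₄ < p₁ ∧ p₁ < p₂ ∧ p₂ < p₃) ∨ (p₃ < p₂ ∧ p₂ < p₁ ∧ p₁ < p₄))) ∨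
  ((a₂ ∈ Ioo a₃ a₁ ∧ a₄ ∈ Ioo a₃ a₁) ∧
    ((p₁ < p₄ ∧ p₄ < p₃ ∧ p₃ < p₂) ∨ (p₂ < p₃ ∧ p₃ < p₄ ∧ p₄ < p₁))) ∨
  ((a₁ ∈ Ioo a₂ a₄ ∧ a₃ ∈ Ioo a₂ a₄) ∧
    ((p₁ < p₂ ∧ p₂ < p₃ ∧ p₃ < p₄) ∨ (p₄ < p₃ ∧ p₃ < p₂ ∧ p₂ < p₁))) ∨
  ((a₁ ∈ Ioo a₄ a₂ ∧ a₃ ∈ Ioo a₄ a₂) ∧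
    ((p₃ < p₄ ∧ p₄ < p₁ ∧ p₁ < p₂) ∨ (p₂ < p₁ ∧ p₁ < p₄ ∧ p₄ < p₃))) ∨
  (max a₁ a₃ < min a₂ a₄ ∧
    ((p₄ < p₁ ∧ p₁ < p₃ ∧ p₃ < p₂) ∨ (p₂ < p₃ ∧ p₃ < p₁ ∧ p₁ < p₄) ∨
     (p₄ < p₃ ∧ p₃ < p₁ ∧ p₁ < p₂) ∨ (p₂ < p₁ ∧ p₁ < p₃ ∧ p₃ < p₄) ∨
     (p₄ < p₁ ∧ p₁ = p₃ ∧ p₃ < p₂) ∨ (p₂ < p₃ ∧ p₃ = p₁ ∧ p₁ < p₄))) ∨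
  (max a₂ a₄ < min a₁ a₃ ∧
    ((p₁ < p₄ ∧ p₄ < p₂ ∧ p₂ < p₃) ∨ (p₃ < p₂ ∧ p₂ < p₄ ∧ p₄ < p₁) ∨
     (p₃ < p₄ ∧ p₄ < p₂ ∧ p₂ < p₁) ∨ (p₁ < p₂ ∧ p₂ < p₄ ∧ p₄ < p₃) ∨
     (p₁ < p₄ ∧ p₄ = p₂ ∧ p₂ < p₃) ∨ (p₃ < p₂ ∧ p₂ = p₄ ∧ p₄ < p₁)))

/-! The vertices lie over the fixed points `p i` at heights `O(ε)`, so the area of the quadrilateral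
is `O(ε)` while its horizontal extent stays fixed. If the product is negative, the table yields a
vertical strip of width `d > 0`, independent of `ε`, that separates the sides x₄x₁ and x₂x₃. A
semicircle about `0` of radius between `z₄` and `1` has one end in `(z₄, 1)` and the other in `(-∞,
0)`, so its image crosses the strip and has length at least `d`. The length-area inequality
(`length_area_halfAnnulus`) gives `(d² / π) (-log z₄) ≤ area = O(ε)`, hence `z₄ → 1`. If the product
is positive, the same argument with semicircles about `1` gives `1 - z₄ → 1`.

No correspondence between boundary intervals and sides is needed. By convexity the boundary curve
meets a vertical line of the strip at most twice, and the intermediate value theorem already places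
two such points in `(0, z₄)` and beyond `1`, so the curve cannot enter the strip elsewhere
(`le_and_ge_of_two_to_one`). -/

open MeasureTheory

/-! ### The length-area method. -/

/-- If a path over `[0, π]` moves by at least `d`, its energy is at least `d ^ 2 / π`. -/
theorem ofReal_sq_div_pi_le_lintegral_sq_norm_deriv {h h' : ℝ → ℂ} {d : ℝ} (hd : 0 < d)
    (hc : ContinuousOn h (Icc 0 Real.pi)) (hh : ∀ t ∈ Ioo 0 Real.pi, HasDerivAt h (h' t) t)
    (hm : Measurable h') (hdist : d ≤ ‖h Real.pi - h 0‖) :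
    ENNReal.ofReal (d ^ 2 / Real.pi) ≤
      ∫⁻ t in Ioo 0 Real.pi, ENNReal.ofReal (‖h' t‖ ^ 2) := by
  by_cases htop : (∫⁻ t in Ioo 0 Real.pi, ENNReal.ofReal (‖h' t‖ ^ 2)) = ⊤
  · rw [htop]
    exact le_top
  have hpi := Real.pi_pos
  have hsq : Integrable (fun t => ‖h' t‖ ^ 2) (volume.restrict (Ioo 0 Real.pi)) := by
    refine ⟨(hm.norm.pow_const 2).aestronglyMeasurable, ?_⟩
    rw [hasFiniteIntegral_iff_ofReal (ae_of_all _ fun t => by positivity)]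
    exact lt_top_iff_ne_top.2 htop
  have hint : Integrable h' (volume.restrict (Ioo 0 Real.pi)) := by
    refine ((integrable_const (1 : ℝ)).add hsq).mono' hm.aestronglyMeasurable
      (ae_of_all _ fun t => ?_)
    simp only [Pi.add_apply]
    nlinarith [sq_nonneg (‖h' t‖ - 1)]
  have hint' : IntervalIntegrable h' volume 0 Real.pi := by
    rw [intervalIntegrable_iff_integrableOn_Ioo_of_le hpi.le]; exact hint
  have ftc := intervalIntegral.integral_eq_sub_of_hasDerivAt_of_le hpi.le hc hh hint'
  rw [intervalIntegral.integral_of_le hpi.le, integral_Ioc_eq_integral_Ioo] at ftc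
  have h1 : d ≤ ∫ t in Ioo 0 Real.pi, ‖h' t‖ := by
    rw [← ftc] at hdist
    exact hdist.trans (norm_integral_le_integral_norm _)
  -- Cauchy–Schwarz in pointwise AM-GM form; the weights give equality at the constant speed `d /
  -- π`.
  have h2 : ∫ t in Ioo 0 Real.pi, ‖h' t‖ ≤
      ∫ t in Ioo 0 Real.pi, (Real.pi / (2 * d) * ‖h' t‖ ^ 2 + d / (2 * Real.pi)) := by
    refine integral_mono hint.norm ((hsq.const_mul _).add (integrable_const _)) fun t => ?_
    have : Real.pi / (2 * d) * ‖h' t‖ ^ 2 + d / (2 * Real.pi) - ‖h' t‖ =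
        (Real.pi * ‖h' t‖ - d) ^ 2 / (2 * d * Real.pi) := by
      field_simp; ring
    have h0 : 0 ≤ (Real.pi * ‖h' t‖ - d) ^ 2 / (2 * d * Real.pi) := by positivity
    show ‖h' t‖ ≤ _
    linarith
  rw [integral_add (hsq.const_mul _) (integrable_const _), integral_const_mul] at h2
  simp only [integral_const, MeasurableSet.univ, measureReal_restrict_apply, univ_inter,
    Real.volume_real_Ioo_of_le hpi.le, sub_zero, smul_eq_mul] at h2
  rw [← ofReal_integral_eq_lintegral_ofReal hsq (ae_of_all _ fun t => by positivity)]
  apply ENNReal.ofReal_le_ofReal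
  set J := ∫ t in Ioo 0 Real.pi, ‖h' t‖ ^ 2
  have h3 : d ≤ Real.pi / (2 * d) * J + Real.pi * (d / (2 * Real.pi)) := h1.trans h2
  have h4 : Real.pi / (2 * d) * J + Real.pi * (d / (2 * Real.pi)) = (Real.pi * J + d ^ 2) / (2 * d) := by
    field_simp
  rw [h4, le_div_iff₀ (by positivity)] at h3
  rw [div_le_iff₀ hpi]
  nlinarith

theorem det_mul_eq_sq_norm (c : ℂ) : (c • (1 : ℂ →L[ℝ] ℂ)).det = ‖c‖ ^ 2 := by
  have : ((c • (1 : ℂ →L[ℝ] ℂ) : ℂ →L[ℝ] ℂ) : ℂ →ₗ[ℝ] ℂ) = Algebra.lmul ℝ ℂ c := by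
    ext
    simp
  rw [ContinuousLinearMap.det, this]
  have h := Algebra.norm_complex_eq
  rw [← Complex.normSq_eq_norm_sq, ← Algebra.norm_complex_apply, Algebra.norm_apply]

/-- The length-area inequality for the half annulus with center `c` and radii `z`, `1`. -/
theorem length_area_halfAnnulus {w : ℂ → ℂ} {c z d : ℝ} (hd : 0 < d) (hz : z ∈ Ioo (0 : ℝ) 1)
    (hw : DifferentiableOn ℂ w openUpperHalfPlane) (hinj : InjOn w openUpperHalfPlane)
    (hcont : ContinuousOn w closedUpperHalfPlane)
    (hdist : ∀ r ∈ Ioo z 1, d ≤ ‖w ((c - r : ℝ) : ℂ) - w ((c + r : ℝ) : ℂ)‖) :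
    ENNReal.ofReal (d ^ 2 / Real.pi) * ENNReal.ofReal (-Real.log z) ≤
      volume (w '' openUpperHalfPlane) := by
  have hpi := Real.pi_pos
  -- In logarithmic coordinates the half annulus is a rectangle whose vertical segments are the
  -- semicircles; its width `-log z` becomes the factor in the bound.
  set S : Set ℂ := Ioo (Real.log z) 0 ×ℂ Ioo 0 Real.pi
  set e : ℂ → ℂ := fun s => c + Complex.exp s with he
  have him : ∀ s, (e s).im = Real.exp s.re * Real.sin s.im := fun s => by
    simp [he, Complex.exp_im]
  have hmaps : MapsTo e S openUpperHalfPlane := fun s hs => by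
    show 0 < (e s).im
    rw [him]
    exact mul_pos (Real.exp_pos _) (Real.sin_pos_of_pos_of_lt_pi hs.2.1 hs.2.2)
  have hopen : IsOpen openUpperHalfPlane := isOpen_lt continuous_const Complex.continuous_im
  have hSm : MeasurableSet S := (measurableSet_Ioo.preimage Complex.measurable_re).inter
    (measurableSet_Ioo.preimage Complex.measurable_im)
  have heinj : InjOn e S := fun s hs t ht hst => by
    have : Complex.exp s = Complex.exp t := add_left_cancel hst
    have h1 : 0 < s.im := hs.2.1
    have h2 : 0 < t.im := ht.2.1
    exact Complex.exp_inj_of_neg_pi_lt_of_le_pi (by linarith) hs.2.2.le (by linarith) ht.2.2.le this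
  set g : ℂ → ℂ := w ∘ e with hg
  have hed : ∀ s, DifferentiableAt ℂ e s := fun s => by fun_prop
  have hgd : ∀ s ∈ S, HasDerivAt g (deriv g s) s := fun s hs =>
    (((hw _ (hmaps hs)).differentiableAt (hopen.mem_nhds (hmaps hs))).comp s (hed s)).hasDerivAt
  have hginj : InjOn g S := hinj.comp heinj hmaps
  have harea := lintegral_abs_det_fderiv_eq_addHaar_image volume hSm
    (fun s hs => (hgd s hs).complexToReal_fderiv.hasFDerivWithinAt) hginj
  simp only [det_mul_eq_sq_norm, abs_pow, abs_norm] at harea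
  have hle : volume (g '' S) ≤ volume (w '' openUpperHalfPlane) := by
    apply measure_mono
    rw [hg, image_comp]
    exact image_mono hmaps.image_subset
  refine le_trans ?_ (harea.trans_le hle)
  have hmd : Measurable (deriv g) := measurable_deriv g
  have hpre : S = Complex.measurableEquivRealProd ⁻¹'
      (Ioo (Real.log z) 0 ×ˢ Ioo 0 Real.pi) := rfl
  have hF : Measurable fun q : ℝ × ℝ => ENNReal.ofReal (‖deriv g ⟨q.1, q.2⟩‖ ^ 2) :=
    ((hmd.comp Complex.measurableEquivRealProd.symm.measurable).norm.pow_const 2).ennreal_ofReal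
  have hprod : ∫⁻ s in S, ENNReal.ofReal (‖deriv g s‖ ^ 2) =
      ∫⁻ x in Ioo (Real.log z) 0, ∫⁻ y in Ioo 0 Real.pi,
        ENNReal.ofReal (‖deriv g ⟨x, y⟩‖ ^ 2) := by
    rw [hpre]
    have := Complex.volume_preserving_equiv_real_prod.setLIntegral_comp_preimage
      (s := Ioo (Real.log z) 0 ×ˢ Ioo 0 Real.pi) (measurableSet_Ioo.prod measurableSet_Ioo) hF
    refine Eq.trans ?_ (this.trans ?_)
    · rfl
    · rw [Measure.volume_eq_prod, ← Measure.prod_restrict]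
      exact lintegral_prod _ hF.aemeasurable
  rw [hprod]
  have hline : ∀ x ∈ Ioo (Real.log z) 0, ENNReal.ofReal (d ^ 2 / Real.pi) ≤
      ∫⁻ y in Ioo 0 Real.pi, ENNReal.ofReal (‖deriv g ⟨x, y⟩‖ ^ 2) := fun x hx => by
    have hl : ∀ t : ℝ, HasDerivAt (fun t : ℝ => (x : ℂ) + t * Complex.I) Complex.I t := fun t => by
      simpa using (((hasDerivAt_id t).ofReal_comp).mul_const Complex.I).const_add (x : ℂ)
    have hmk : ∀ t : ℝ, (⟨x, t⟩ : ℂ) = x + t * Complex.I := fun t => Complex.mk_eq_add_mul_I x t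
    have key := ofReal_sq_div_pi_le_lintegral_sq_norm_deriv (h := fun t => g (x + t * Complex.I))
      (h' := fun t => deriv g ⟨x, t⟩ * Complex.I) hd ?_ ?_ ?_ ?_
    · simpa using key
    · refine hcont.comp (by fun_prop) fun t ht => ?_
      show 0 ≤ (e _).im
      rw [him]
      simpa using mul_nonneg (Real.exp_pos x).le (Real.sin_nonneg_of_nonneg_of_le_pi ht.1 ht.2)
    · intro t ht
      have hmem : (⟨x, t⟩ : ℂ) ∈ S := ⟨hx, ht⟩
      have := hgd _ hmem
      rw [hmk] at this ⊢
      exact HasDerivAt.comp (h₂ := g) t this (hl t)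
    · exact (hmd.comp (Complex.measurableEquivRealProd.symm.measurable.comp
        measurable_prodMk_left)).mul_const _
    · have := hdist (Real.exp x) ⟨(Real.log_lt_iff_lt_exp hz.1).1 hx.1,
        by simpa using hx.2⟩
      convert this using 4
      · simp [hg, he, Complex.exp_add, sub_eq_add_neg]
      · simp [hg, he]
  calc ENNReal.ofReal (d ^ 2 / Real.pi) * ENNReal.ofReal (-Real.log z)
      = ∫⁻ x in Ioo (Real.log z) 0, ENNReal.ofReal (d ^ 2 / Real.pi) := by
        simp [Real.volume_Ioo]
    _ ≤ _ := setLIntegral_mono' measurableSet_Ioo hline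

/-! ### Vertical lines and convex bodies in the plane. -/

/-- A vertical line that separates two points of a convex body meets its interior. -/
theorem Convex.exists_mem_interior_re_eq {K : Set ℂ} (hK : Convex ℝ K) (hne : (interior K).Nonempty)
    {c : ℝ} {y z : ℂ} (hy : y ∈ K) (hz : z ∈ K) (hyc : y.re < c) (hcz : c < z.re) :
    ∃ m ∈ interior K, m.re = c := by
  obtain ⟨q, hq⟩ := hne
  have key : ∀ v ∈ K, (c - q.re) / (v.re - q.re) ∈ Ioo (0 : ℝ) 1 →
      ∃ m ∈ interior K, m.re = c := by
    intro v hv ht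
    set t := (c - q.re) / (v.re - q.re) with htdef
    -- A zero denominator would give `t = 0`, as `x / 0 = 0`.
    have hne : v.re - q.re ≠ 0 := fun h => by simp [htdef, h] at ht
    refine ⟨_, hK.openSegment_interior_self_subset_interior hq hv
      ⟨1 - t, t, by linarith [ht.2], ht.1, by ring, rfl⟩, ?_⟩
    have : t * (v.re - q.re) = c - q.re := div_mul_cancel₀ _ hne
    simp only [Complex.add_re, Complex.smul_re, smul_eq_mul]
    linarith
  rcases lt_trichotomy q.re c with h | h | h
  · exact key z hz ⟨div_pos (by linarith) (by linarith),
      (div_lt_one (by linarith)).2 (by linarith)⟩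
  · exact ⟨q, hq, h⟩
  · exact key y hy ⟨div_pos_of_neg_of_neg (by linarith) (by linarith),
      (div_lt_one_of_neg (by linarith)).2 (by linarith)⟩

/-- A point of a vertical line strictly between an interior point and another point of a convex
set is an interior point. -/
theorem Convex.mem_interior_of_im_between {K : Set ℂ} (hK : Convex ℝ K) {m u v : ℂ}
    (hm : m ∈ interior K) (hv : v ∈ K) (hu : u.re = m.re) (hvre : v.re = m.re)
    (ht : (u.im - m.im) / (v.im - m.im) ∈ Ioo (0 : ℝ) 1) : u ∈ interior K := by
  set t := (u.im - m.im) / (v.im - m.im) with htdef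
  have hne : v.im - m.im ≠ 0 := fun h => by simp [htdef, h] at ht
  refine hK.openSegment_interior_self_subset_interior hm hv
    ⟨1 - t, t, by linarith [ht.2], ht.1, by ring, ?_⟩
  have h : t * (v.im - m.im) = u.im - m.im := div_mul_cancel₀ _ hne
  apply Complex.ext
  · simp only [Complex.add_re, Complex.smul_re, smul_eq_mul]
    rw [hvre, hu]; ring
  · simp only [Complex.add_im, Complex.smul_im, smul_eq_mul]
    linarith

/-- A vertical line that meets the interior of a convex set meets the rest of it in at most two
points. -/
theorem Convex.eq_or_eq_or_eq_of_re_eq {K : Set ℂ} (hK : Convex ℝ K) {m u₁ u₂ u₃ : ℂ}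
    (hm : m ∈ interior K) (h₁ : u₁ ∈ K \ interior K) (h₂ : u₂ ∈ K \ interior K)
    (h₃ : u₃ ∈ K \ interior K) (hr₁ : u₁.re = m.re) (hr₂ : u₂.re = m.re) (hr₃ : u₃.re = m.re) :
    u₁ = u₂ ∨ u₁ = u₃ ∨ u₂ = u₃ := by
  have hlow : ∀ u v : ℂ, u ∈ K \ interior K → v ∈ K \ interior K → u.re = m.re → v.re = m.re →
      u.im < m.im → v.im < m.im → u = v := by
    have : ∀ u v : ℂ, u ∈ K \ interior K → v ∈ K \ interior K → u.re = m.re → v.re = m.re →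
        u.im < m.im → v.im < m.im → ¬ v.im < u.im := fun u v hu hv hur hvr hum hvm hvu =>
      hu.2 (hK.mem_interior_of_im_between hm hv.1 hur hvr
        ⟨div_pos_of_neg_of_neg (by linarith) (by linarith),
          (div_lt_one_of_neg (by linarith)).2 (by linarith)⟩)
    intro u v hu hv hur hvr hum hvm
    exact Complex.ext (hur.trans hvr.symm) (le_antisymm (not_lt.1 (this u v hu hv hur hvr hum hvm))
      (not_lt.1 (this v u hv hu hvr hur hvm hum)))
  have hhigh : ∀ u v : ℂ, u ∈ K \ interior K → v ∈ K \ interior K → u.re = m.re → v.re = m.re →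
      m.im < u.im → m.im < v.im → u = v := by
    have : ∀ u v : ℂ, u ∈ K \ interior K → v ∈ K \ interior K → u.re = m.re → v.re = m.re →
        m.im < u.im → m.im < v.im → ¬ u.im < v.im := fun u v hu hv hur hvr hum hvm hvu =>
      hu.2 (hK.mem_interior_of_im_between hm hv.1 hur hvr
        ⟨div_pos (by linarith) (by linarith), (div_lt_one (by linarith)).2 (by linarith)⟩)
    intro u v hu hv hur hvr hum hvm
    exact Complex.ext (hur.trans hvr.symm) (le_antisymm (not_lt.1 (this v u hv hu hvr hur hvm hum))
      (not_lt.1 (this u v hu hv hur hvr hum hvm)))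
  have hne : ∀ u : ℂ, u ∈ K \ interior K → u.re = m.re → u.im < m.im ∨ m.im < u.im :=
    fun u hu hur => lt_or_gt_of_ne fun h => hu.2 (by rwa [Complex.ext hur h])
  -- Pigeonhole: two of the three points lie on the same side of `m`.
  rcases hne u₁ h₁ hr₁ with i₁ | i₁ <;> rcases hne u₂ h₂ hr₂ with i₂ | i₂ <;>
    rcases hne u₃ h₃ hr₃ with i₃ | i₃ <;> first
      | exact Or.inl (hlow _ _ h₁ h₂ hr₁ hr₂ i₁ i₂)
      | exact Or.inl (hhigh _ _ h₁ h₂ hr₁ hr₂ i₁ i₂)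
      | exact Or.inr (Or.inl (hlow _ _ h₁ h₃ hr₁ hr₃ i₁ i₃))
      | exact Or.inr (Or.inl (hhigh _ _ h₁ h₃ hr₁ hr₃ i₁ i₃))
      | exact Or.inr (Or.inr (hlow _ _ h₂ h₃ hr₂ hr₃ i₂ i₃))
      | exact Or.inr (Or.inr (hhigh _ _ h₂ h₃ hr₂ hr₃ i₂ i₃))

/-! ### Real functions that take each value of an interval at most twice. -/

/-- A continuous function on the line takes a value `c` between `v a` and its limit at infinity. -/
theorem exists_gt_eq_of_tendsto_atTop {v : ℝ → ℝ} (hv : Continuous v) {a c l : ℝ} (ha : v a < c)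
    (hl : Tendsto v atTop (𝓝 l)) (hc : c < l) : ∃ t > a, v t = c := by
  obtain ⟨b, hb, hab⟩ := ((hl.eventually_const_lt hc).and (eventually_gt_atTop a)).exists
  obtain ⟨t, ht, rfl⟩ := intermediate_value_Ioo hab.le hv.continuousOn ⟨ha, hb⟩
  exact ⟨t, ht.1, rfl⟩

/-- A preconnected set on which `v` omits the values in `(α, β)` and takes one value `≤ α` is
mapped below `α`. -/
theorem IsPreconnected.le_of_forall_ne {v : ℝ → ℝ} (hv : Continuous v) {s : Set ℝ}
    (hs : IsPreconnected s) {α β a : ℝ} (hαβ : α < β) (ha : a ∈ s) (hva : v a ≤ α)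
    (hne : ∀ c ∈ Ioo α β, ∀ t ∈ s, v t ≠ c) {t : ℝ} (ht : t ∈ s) : v t ≤ α := by
  by_contra! h
  obtain ⟨c, hc₁, hc₂⟩ := exists_between (lt_min h hαβ)
  obtain ⟨t', ht', h'⟩ := hs.intermediate_value ha ht hv.continuousOn
    ⟨hva.trans hc₁.le, (hc₂.trans_le (min_le_left _ _)).le⟩
  exact hne c ⟨hc₁, hc₂.trans_le (min_le_right _ _)⟩ t' ht' h'

/-- If `v` takes no value in `(α, β)` three times, `v z, v 1 ≤ α` and `v 0, v (∞) ≥ β`, then `v` is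
at most `α` on `[z, 1]` and at least `β` on `(-∞, 0]`. -/
theorem le_and_ge_of_two_to_one {v : ℝ → ℝ} (hv : Continuous v) {z α β l : ℝ}
    (hz : z ∈ Ioo (0 : ℝ) 1) (hαβ : α < β)
    (htwo : ∀ c ∈ Ioo α β, ∀ t₁ t₂ t₃, v t₁ = c → v t₂ = c → v t₃ = c →
      t₁ = t₂ ∨ t₁ = t₃ ∨ t₂ = t₃)
    (hvz : v z ≤ α) (hv1 : v 1 ≤ α) (hv0 : β ≤ v 0) (hl : Tendsto v atTop (𝓝 l)) (hβl : β ≤ l) :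
    (∀ t ∈ Icc z 1, v t ≤ α) ∧ ∀ t ≤ 0, β ≤ v t := by
  have hne : ∀ c ∈ Ioo α β, ∀ t, v t = c → t ∈ Ioo 0 z ∨ 1 < t := by
    intro c hc t ht
    obtain ⟨s₁, hs₁, e₁⟩ := intermediate_value_Ioo' hz.1.le hv.continuousOn
      ⟨hvz.trans_lt hc.1, hc.2.trans_le hv0⟩
    obtain ⟨s₂, hs₂, e₂⟩ := exists_gt_eq_of_tendsto_atTop hv (hv1.trans_lt hc.1) hl
      (hc.2.trans_le hβl)
    rcases htwo c hc t s₁ s₂ ht e₁ e₂ with h | h | h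
    · exact Or.inl (h ▸ hs₁)
    · exact Or.inr (h ▸ hs₂)
    · have := hs₁.2; have := hz.2; have := hs₂.lt; linarith
  constructor
  · refine fun t ht => isPreconnected_Icc.le_of_forall_ne hv hαβ (right_mem_Icc.2 hz.2.le) hv1 ?_ ht
    intro c hc t ht htc
    rcases hne c hc t htc with h | h
    · exact h.2.not_ge ht.1
    · exact h.not_ge ht.2
  · intro t ht
    have := (isPreconnected_Iic (a := (0 : ℝ))).le_of_forall_ne
      (v := fun t => -v t) hv.neg (neg_lt_neg hαβ)
      (mem_Iic.2 le_rfl) (neg_le_neg hv0) ?_ ht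
    · linarith
    · intro c hc t ht htc
      rcases hne (-c) ⟨by linarith [hc.2], by linarith [hc.1]⟩ t (by rw [← htc, neg_neg]) with h | h
      · exact h.1.not_ge ht
      · have : t ≤ 0 := ht
        linarith

/-- A function that takes no value in `(α, β)` three times and whose values at `z, 1` and at `0, ∞`
are separated by `(α, β)` oscillates by at least `β - α` between `r` and `-r` if `z < r < 1`. -/
theorem sub_le_abs_sub_of_two_to_one {v : ℝ → ℝ} (hv : Continuous v) {z α β l : ℝ}
    (hz : z ∈ Ioo (0 : ℝ) 1) (hαβ : α < β)
    (htwo : ∀ c ∈ Ioo α β, ∀ t₁ t₂ t₃, v t₁ = c → v t₂ = c → v t₃ = c →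
      t₁ = t₂ ∨ t₁ = t₃ ∨ t₂ = t₃)
    (hl : Tendsto v atTop (𝓝 l))
    (hsep : (v z ≤ α ∧ v 1 ≤ α ∧ β ≤ v 0 ∧ β ≤ l) ∨ (β ≤ v z ∧ β ≤ v 1 ∧ v 0 ≤ α ∧ l ≤ α))
    {r : ℝ} (hr : r ∈ Ioo z 1) : β - α ≤ |v (-r) - v r| := by
  have hr0 : -r ≤ 0 := by linarith [hr.1, hz.1]
  rcases hsep with ⟨h₁, h₂, h₃, h₄⟩ | ⟨h₁, h₂, h₃, h₄⟩
  · obtain ⟨hA, hB⟩ := le_and_ge_of_two_to_one hv hz hαβ htwo h₁ h₂ h₃ hl h₄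
    exact le_trans (by linarith [hA r ⟨hr.1.le, hr.2.le⟩, hB _ hr0]) (le_abs_self _)
  · obtain ⟨hA, hB⟩ := le_and_ge_of_two_to_one (v := fun t => -v t) hv.neg hz (neg_lt_neg hαβ)
      (fun c hc t₁ t₂ t₃ e₁ e₂ e₃ => htwo (-c) ⟨by linarith [hc.2], by linarith [hc.1]⟩ t₁ t₂ t₃
        (by rw [← e₁, neg_neg]) (by rw [← e₂, neg_neg]) (by rw [← e₃, neg_neg]))
      (neg_le_neg h₁) (neg_le_neg h₂) (neg_le_neg h₃) hl.neg (neg_le_neg h₄)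
    exact le_trans (by linarith [hA r ⟨hr.1.le, hr.2.le⟩, hB _ hr0]) (neg_le_abs _)

/-! ### Boundary values of the Schwarz–Christoffel map. -/

namespace IsSchwarzChristoffel

variable {w : ℂ → ℂ} {x : Fin 4 → ℂ}

theorem continuous_ofReal {P : Set ℂ} {y : ℂ} (hw : IsSchwarzChristoffel w P y) :
    Continuous fun t : ℝ => w t :=
  hw.continuousOn.comp_continuous Complex.continuous_ofReal fun t => by
    simp [closedUpperHalfPlane]

theorem tendsto_ofReal {P : Set ℂ} {y : ℂ} (hw : IsSchwarzChristoffel w P y) :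
    Tendsto (fun t : ℝ => w t) (cocompact ℝ) (𝓝 y) :=
  hw.tendsto_infty.comp <| tendsto_inf.2
    ⟨Complex.isometry_ofReal.isClosedEmbedding.tendsto_cocompact,
      tendsto_principal.2 (Eventually.of_forall fun t => by simp [closedUpperHalfPlane])⟩

/-- An interior value would also be attained in the open half plane, against injectivity on the
closed one. -/
theorem mem_hull_diff_interior (hw : IsSchwarzChristoffel w (quadInterior x) (x 1)) (t : ℝ) :
    w t ∈ convexHull ℝ (range x) \ interior (convexHull ℝ (range x)) := by
  have ht : (t : ℂ) ∈ closedUpperHalfPlane := by simp [closedUpperHalfPlane]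
  have hclosed : IsClosed (convexHull ℝ (range x)) :=
    ((finite_range x).isCompact_convexHull ℝ).isClosed
  refine ⟨closure_minimal interior_subset hclosed (hw.bijOn_closed.mapsTo ht).1, fun h => ?_⟩
  obtain ⟨s, hs, hst⟩ := hw.bijOn.surjOn h
  have : s = t := hw.bijOn_closed.injOn (show 0 ≤ s.im from le_of_lt hs) ht hst
  rw [this] at hs
  simp [openUpperHalfPlane] at hs

/-- Between two vertices, the boundary curve meets each vertical line at most twice. -/
theorem eq_or_eq_or_eq_of_re_eq (hw : IsSchwarzChristoffel w (quadInterior x) (x 1)) {c : ℝ}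
    {i j : Fin 4} (hi : (x i).re < c) (hj : c < (x j).re) {t₁ t₂ t₃ : ℝ}
    (h₁ : (w t₁).re = c) (h₂ : (w t₂).re = c) (h₃ : (w t₃).re = c) :
    t₁ = t₂ ∨ t₁ = t₃ ∨ t₂ = t₃ := by
  have hK : Convex ℝ (convexHull ℝ (range x)) := convex_convexHull ℝ _
  have hx : ∀ i, x i ∈ convexHull ℝ (range x) := fun i => subset_convexHull ℝ _ (mem_range_self i)
  have hne : (interior (convexHull ℝ (range x))).Nonempty :=
    ⟨w Complex.I, hw.bijOn.mapsTo (by simp [openUpperHalfPlane])⟩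
  obtain ⟨m, hm, rfl⟩ := hK.exists_mem_interior_re_eq hne (hx i) (hx j) hi hj
  have hinj : ∀ s t : ℝ, w s = w t → s = t := fun s t h => Complex.ofReal_injective <|
    hw.bijOn_closed.injOn (by simp [closedUpperHalfPlane]) (by simp [closedUpperHalfPlane]) h
  exact (hK.eq_or_eq_or_eq_of_re_eq hm (hw.mem_hull_diff_interior t₁) (hw.mem_hull_diff_interior t₂)
    (hw.mem_hull_diff_interior t₃) h₁ h₂ h₃).imp (hinj _ _) (Or.imp (hinj _ _) (hinj _ _))

/-- If a vertical strip of width `β - α` separates the sides `x₄x₁` and `x₂x₃`, the area of the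
quadrilateral controls `-log z₄`. -/
theorem neg_log_le_of_separated (hw : IsSchwarzChristoffel w (quadInterior x) (x 1))
    (h1 : w 1 = x 0) (h0 : w 0 = x 2) {z : ℝ} (hz : z ∈ Ioo (0 : ℝ) 1) (hwz : w z = x 3)
    {α β : ℝ} (hαβ : α < β)
    (hsep : ((x 3).re ≤ α ∧ (x 0).re ≤ α ∧ β ≤ (x 2).re ∧ β ≤ (x 1).re) ∨
      (β ≤ (x 3).re ∧ β ≤ (x 0).re ∧ (x 2).re ≤ α ∧ (x 1).re ≤ α)) :
    ENNReal.ofReal ((β - α) ^ 2 / Real.pi) * ENNReal.ofReal (-Real.log z) ≤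
      volume (quadInterior x) := by
  rw [← hw.bijOn.image_eq]
  refine length_area_halfAnnulus (c := 0) (sub_pos.2 hαβ) hz hw.holomorphic hw.bijOn.injOn
    hw.continuousOn fun r hr => ?_
  have := sub_le_abs_sub_of_two_to_one (v := fun t => (w t).re)
    (Complex.continuous_re.comp hw.continuous_ofReal) hz hαβ
    (fun c hc t₁ t₂ t₃ e₁ e₂ e₃ => ?_)
    ((Complex.continuous_re.tendsto _).comp (hw.tendsto_ofReal.mono_left atTop_le_cocompact))
    (by simpa [h1, h0, hwz] using hsep) hr
  · refine this.trans ?_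
    rw [← Complex.sub_re, zero_sub, zero_add]
    exact Complex.abs_re_le_norm _
  · rcases hsep with h | h
    · exact hw.eq_or_eq_or_eq_of_re_eq (h.1.trans_lt hc.1) (hc.2.trans_le h.2.2.1) e₁ e₂ e₃
    · exact hw.eq_or_eq_or_eq_of_re_eq (h.2.2.1.trans_lt hc.1) (hc.2.trans_le h.1) e₁ e₂ e₃

/-- If a vertical strip of width `β - α` separates the sides `x₃x₄` and `x₁x₂`, the area of the
quadrilateral controls `-log (1 - z₄)`. -/
theorem neg_log_one_sub_le_of_separated (hw : IsSchwarzChristoffel w (quadInterior x) (x 1))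
    (h1 : w 1 = x 0) (h0 : w 0 = x 2) {z : ℝ} (hz : z ∈ Ioo (0 : ℝ) 1) (hwz : w z = x 3)
    {α β : ℝ} (hαβ : α < β)
    (hsep : ((x 3).re ≤ α ∧ (x 2).re ≤ α ∧ β ≤ (x 0).re ∧ β ≤ (x 1).re) ∨
      (β ≤ (x 3).re ∧ β ≤ (x 2).re ∧ (x 0).re ≤ α ∧ (x 1).re ≤ α)) :
    ENNReal.ofReal ((β - α) ^ 2 / Real.pi) * ENNReal.ofReal (-Real.log (1 - z)) ≤
      volume (quadInterior x) := by
  have hz' : 1 - z ∈ Ioo (0 : ℝ) 1 := ⟨by linarith [hz.2], by linarith [hz.1]⟩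
  rw [← hw.bijOn.image_eq]
  refine length_area_halfAnnulus (c := 1) (sub_pos.2 hαβ) hz' hw.holomorphic hw.bijOn.injOn
    hw.continuousOn fun r hr => ?_
  have hlim : Tendsto (fun t : ℝ => 1 - t) atTop (cocompact ℝ) :=
    (tendsto_atBot_add_const_left _ 1 tendsto_neg_atTop_atBot).mono_right atBot_le_cocompact
  -- The reflection `t ↦ 1 - t` exchanges `0` with `1` and `z` with `1 - z`, reducing to semicircles
  -- about `0`.
  have := sub_le_abs_sub_of_two_to_one (v := fun t => (w (1 - t : ℝ)).re)
    (Complex.continuous_re.comp (hw.continuous_ofReal.comp (continuous_const.sub continuous_id)))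
    hz' hαβ
    (fun c hc t₁ t₂ t₃ e₁ e₂ e₃ => ?_)
    ((Complex.continuous_re.tendsto _).comp (hw.tendsto_ofReal.comp hlim))
    (by simpa [h1, h0, hwz] using hsep) hr
  · refine this.trans ?_
    rw [← Complex.sub_re, sub_neg_eq_add, norm_sub_rev]
    exact Complex.abs_re_le_norm _
  · have : 1 - t₁ = 1 - t₂ ∨ 1 - t₁ = 1 - t₃ ∨ 1 - t₂ = 1 - t₃ := by
      rcases hsep with h | h
      · exact hw.eq_or_eq_or_eq_of_re_eq (h.1.trans_lt hc.1) (hc.2.trans_le h.2.2.1) e₁ e₂ e₃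
      · exact hw.eq_or_eq_or_eq_of_re_eq (h.2.2.1.trans_lt hc.1) (hc.2.trans_le h.1) e₁ e₂ e₃
    simpa using this

end IsSchwarzChristoffel

/-! ### Area bound, separating strips from the table, and the limit. -/

/-- A quadrilateral with vertices in a rectangle has at most its area. -/
theorem volume_quadInterior_le {x : Fin 4 → ℂ} {R M : ℝ} (hre : ∀ i, |(x i).re| ≤ R)
    (him : ∀ i, |(x i).im| ≤ M) :
    volume (quadInterior x) ≤ ENNReal.ofReal (2 * R) * ENNReal.ofReal (2 * M) := by
  have hsub : quadInterior x ⊆ Icc (-R) R ×ℂ Icc (-M) M := by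
    refine interior_subset.trans (convexHull_min ?_ ?_)
    · rintro _ ⟨i, rfl⟩
      exact ⟨abs_le.1 (hre i), abs_le.1 (him i)⟩
    · exact ((convex_Icc _ _).linear_preimage Complex.reLm).inter
        ((convex_Icc _ _).linear_preimage Complex.imLm)
  refine (measure_mono hsub).trans_eq ?_
  have : Icc (-R) R ×ℂ Icc (-M) M =
      Complex.measurableEquivRealProd ⁻¹' (Icc (-R) R ×ˢ Icc (-M) M) := rfl
  rw [this, Complex.volume_preserving_equiv_real_prod.measure_preimage
    (measurableSet_Icc.prod measurableSet_Icc).nullMeasurableSet, Measure.volume_eq_prod,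
    Measure.prod_prod, Real.volume_Icc, Real.volume_Icc]
  ring_nf

theorem QuadTable.slopes_ne {a₁ a₂ a₃ a₄ p₁ p₂ p₃ p₄ : ℝ}
    (h : QuadTable a₁ a₂ a₃ a₄ p₁ p₂ p₃ p₄) : a₂ ≠ a₁ ∧ a₃ ≠ a₂ ∧ a₄ ≠ a₃ ∧ a₁ ≠ a₄ := by
  simp only [QuadTable, mem_Ioo, max_lt_iff, lt_min_iff] at h
  refine ⟨?_, ?_, ?_, ?_⟩ <;> rintro rfl <;>
    rcases h with ⟨h, -⟩ | ⟨h, -⟩ | ⟨h, -⟩ | ⟨h, -⟩ | ⟨h, -⟩ | ⟨h, -⟩ <;>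
    obtain ⟨⟨_, _⟩, _, _⟩ := h <;> linarith

/-- Only the order of the critical points matters here; the two equalities come from the degenerate
orders in the last two rows, where the product vanishes. -/
theorem QuadTable.separated {a₁ a₂ a₃ a₄ p₁ p₂ p₃ p₄ : ℝ}
    (h : QuadTable a₁ a₂ a₃ a₄ p₁ p₂ p₃ p₄) :
    (max p₄ p₁ < min p₃ p₂ ∨ max p₃ p₂ < min p₄ p₁) ∨
    (max p₄ p₃ < min p₁ p₂ ∨ max p₁ p₂ < min p₄ p₃) ∨ p₃ = p₁ ∨ p₄ = p₂ := by
  simp only [QuadTable] at h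
  simp only [max_lt_iff, lt_min_iff]
  rcases h with ⟨-, h | h⟩ | ⟨-, h | h⟩ | ⟨-, h | h⟩ | ⟨-, h | h⟩ |
    ⟨-, h | h | h | h | h | h⟩ | ⟨-, h | h | h | h | h | h⟩ <;>
    obtain ⟨_, _, _⟩ := h <;> grind

theorem QuadTable.separated_of_neg {a₁ a₂ a₃ a₄ p₁ p₂ p₃ p₄ : ℝ}
    (h : QuadTable a₁ a₂ a₃ a₄ p₁ p₂ p₃ p₄) (hneg : (p₃ - p₁) * (p₄ - p₂) < 0) :
    max p₄ p₁ < min p₃ p₂ ∨ max p₃ p₂ < min p₄ p₁ := by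
  rcases h.separated with h | h | h | h
  · exact h
  · simp only [max_lt_iff, lt_min_iff] at h
    rcases h with h | h <;> nlinarith
  · simp [h] at hneg
  · simp [h] at hneg

theorem QuadTable.separated_of_pos {a₁ a₂ a₃ a₄ p₁ p₂ p₃ p₄ : ℝ}
    (h : QuadTable a₁ a₂ a₃ a₄ p₁ p₂ p₃ p₄) (hpos : 0 < (p₃ - p₁) * (p₄ - p₂)) :
    max p₄ p₃ < min p₁ p₂ ∨ max p₁ p₂ < min p₄ p₃ := by
  rcases h.separated with h | h | h | h
  · simp only [max_lt_iff, lt_min_iff] at h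
    rcases h with h | h <;> nlinarith
  · exact h
  · simp [h] at hpos
  · simp [h] at hpos

/-- Numbers in `(0, 1)` with `-log = O(ε)` tend to `1`. -/
theorem tendsto_one_of_neg_log_le {z : ℝ → ℝ} {k C : ℝ} (hk : 0 < k) (hC : 0 ≤ C)
    (hz : ∀ ε > 0, z ε ∈ Ioo (0 : ℝ) 1)
    (h : ∀ ε > 0, ENNReal.ofReal k * ENNReal.ofReal (-Real.log (z ε)) ≤ ENNReal.ofReal (C * ε)) :
    Tendsto z (𝓝[>] 0) (𝓝 1) := by
  have hlow : Tendsto (fun ε : ℝ => Real.exp (-(C * ε / k))) (𝓝[>] 0) (𝓝 1) := by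
    have : Continuous fun ε : ℝ => Real.exp (-(C * ε / k)) := by fun_prop
    simpa using (this.tendsto 0).mono_left nhdsWithin_le_nhds
  refine tendsto_of_tendsto_of_tendsto_of_le_of_le' hlow tendsto_const_nhds ?_ ?_
  · filter_upwards [self_mem_nhdsWithin] with ε hε
    have h' := h ε hε
    have hε' : 0 < ε := hε
    rw [← ENNReal.ofReal_mul hk.le, ENNReal.ofReal_le_ofReal_iff (by positivity)] at h'
    rw [← Real.le_log_iff_exp_le (hz ε hε).1, neg_le, le_div_iff₀ hk]
    linarith
  · filter_upwards [self_mem_nhdsWithin] with ε hε using (hz ε hε).2.le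

/-- The vertices lie above the critical points. -/
theorem re_eq_of_mem_graphSection_inter {f g : ℝ → ℝ} {a b a' b' p ε : ℝ} (hε : 0 < ε)
    (hf : ∀ t, HasDerivAt f (a * t + b) t) (hg : ∀ t, HasDerivAt g (a' * t + b') t)
    (ha : a' ≠ a) (hp : deriv (fun t => g t - f t) p = 0) {x : ℂ}
    (hx : x ∈ graphSection ε f ∩ graphSection ε g) : x.re = p ∧ x.im = ε * (a * p + b) := by
  have h₁ : x.im = ε * deriv f x.re := hx.1
  have h₂ : x.im = ε * deriv g x.re := hx.2
  rw [(hf _).deriv] at h₁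
  rw [(hg _).deriv] at h₂
  have h₃ := ((hg p).sub (hf p)).deriv
  have h₄ : a' * p + b' - (a * p + b) = 0 := h₃.symm.trans hp
  have h₅ : a * x.re + b = a' * x.re + b' := mul_left_cancel₀ hε.ne' (h₁.symm.trans h₂)
  have h₆ : x.re = p := mul_left_cancel₀ (sub_ne_zero.2 ha) (by linarith)
  exact ⟨h₆, by rw [h₁, h₆]⟩

theorem lemma4p7
    (f : Fin 4 → ℝ → ℝ) (a b p : Fin 4 → ℝ)
    -- `graph (df i)` is the line `y = a i * x + b i`
    (hf : ∀ i t, HasDerivAt (f i) (a i * t + b i) t)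
    -- `p i` is the critical point of `f (i + 1) - f i`
    (hp : ∀ i, deriv (fun t => f (i + 1) t - f i t) (p i) = 0)
    (htable : QuadTable (a 0) (a 1) (a 2) (a 3) (p 0) (p 1) (p 2) (p 3))
    (x : ℝ → Fin 4 → ℂ)
    (hx : ∀ ε > 0, ∀ i, x ε i ∈ graphSection ε (f i) ∩ graphSection ε (f (i + 1)))
    (w : ℝ → ℂ → ℂ)
    (hw : ∀ ε > 0, IsSchwarzChristoffel (w ε) (quadInterior (x ε)) (x ε 1))
    (hw₁ : ∀ ε > 0, w ε 1 = x ε 0)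
    (hw₃ : ∀ ε > 0, w ε 0 = x ε 2)
    (z₄ : ℝ → ℝ)
    (hz₄ : ∀ ε > 0, z₄ ε ∈ Ioo (0 : ℝ) 1 ∧ w ε (z₄ ε : ℂ) = x ε 3) :
    ((p 2 - p 0) * (p 3 - p 1) < 0 → Tendsto z₄ (𝓝[>] 0) (𝓝 1)) ∧
    (0 < (p 2 - p 0) * (p 3 - p 1) → Tendsto z₄ (𝓝[>] 0) (𝓝 0)) := by
  have hne : ∀ i, a (i + 1) ≠ a i := by
    obtain ⟨h₀, h₁, h₂, h₃⟩ := htable.slopes_ne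
    intro i
    fin_cases i
    exacts [h₀, h₁, h₂, h₃]
  have hvert : ∀ ε > 0, ∀ i, (x ε i).re = p i ∧ (x ε i).im = ε * (a i * p i + b i) :=
    fun ε hε i => re_eq_of_mem_graphSection_inter hε (hf i) (hf (i + 1)) (hne i) (hp i) (hx ε hε i)
  have hre : ∀ ε > 0, ∀ i, (x ε i).re = p i := fun ε hε i => (hvert ε hε i).1
  -- Sums serve as crude common bounds for the four abscissas and the four rescaled heights.
  set R := ∑ i, |p i|
  set M := ∑ i, |a i * p i + b i|
  have hR0 : 0 ≤ R := Finset.sum_nonneg fun _ _ => abs_nonneg _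
  have hM0 : 0 ≤ M := Finset.sum_nonneg fun _ _ => abs_nonneg _
  have harea : ∀ ε > 0, volume (quadInterior (x ε)) ≤ ENNReal.ofReal (4 * R * M * ε) := by
    intro ε hε
    refine (volume_quadInterior_le (R := R) (M := ε * M) (fun i => ?_) fun i => ?_).trans_eq ?_
    · rw [hre ε hε]
      exact Finset.single_le_sum (f := fun i => |p i|) (fun _ _ => abs_nonneg _)
        (Finset.mem_univ i)
    · rw [(hvert ε hε i).2, abs_mul, abs_of_pos hε]
      exact mul_le_mul_of_nonneg_left (Finset.single_le_sum (f := fun i => |a i * p i + b i|)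
        (fun _ _ => abs_nonneg _) (Finset.mem_univ i)) hε.le
    · rw [← ENNReal.ofReal_mul (by positivity)]
      ring_nf
  have hC : 0 ≤ 4 * R * M := by positivity
  constructor
  · intro hneg
    obtain ⟨α, β, hαβ, hsep⟩ : ∃ α β, α < β ∧ ((p 3 ≤ α ∧ p 0 ≤ α ∧ β ≤ p 2 ∧ β ≤ p 1) ∨
        (β ≤ p 3 ∧ β ≤ p 0 ∧ p 2 ≤ α ∧ p 1 ≤ α)) := by
      rcases htable.separated_of_neg hneg with h | h
      · exact ⟨_, _, h, Or.inl (by simp)⟩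
      · exact ⟨_, _, h, Or.inr (by simp)⟩
    have hd := sub_pos.2 hαβ
    refine tendsto_one_of_neg_log_le (k := (β - α) ^ 2 / Real.pi)
      (div_pos (pow_pos hd 2) Real.pi_pos) hC (fun ε hε => (hz₄ ε hε).1) fun ε hε => ?_
    exact ((hw ε hε).neg_log_le_of_separated (hw₁ ε hε) (hw₃ ε hε) (hz₄ ε hε).1 (hz₄ ε hε).2 hαβ
      (by simpa only [hre ε hε] using hsep)).trans (harea ε hε)
  · intro hpos
    obtain ⟨α, β, hαβ, hsep⟩ : ∃ α β, α < β ∧ ((p 3 ≤ α ∧ p 2 ≤ α ∧ β ≤ p 0 ∧ β ≤ p 1) ∨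
        (β ≤ p 3 ∧ β ≤ p 2 ∧ p 0 ≤ α ∧ p 1 ≤ α)) := by
      rcases htable.separated_of_pos hpos with h | h
      · exact ⟨_, _, h, Or.inl (by simp)⟩
      · exact ⟨_, _, h, Or.inr (by simp)⟩
    have hd := sub_pos.2 hαβ
    have key : Tendsto (fun ε => 1 - z₄ ε) (𝓝[>] 0) (𝓝 1) := by
      refine tendsto_one_of_neg_log_le (k := (β - α) ^ 2 / Real.pi)
        (div_pos (pow_pos hd 2) Real.pi_pos) hC
        (fun ε hε => ⟨by linarith [(hz₄ ε hε).1.2], by linarith [(hz₄ ε hε).1.1]⟩) fun ε hε => ?_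
      exact ((hw ε hε).neg_log_one_sub_le_of_separated (hw₁ ε hε) (hw₃ ε hε) (hz₄ ε hε).1
        (hz₄ ε hε).2 hαβ (by simpa only [hre ε hε] using hsep)).trans (harea ε hε)
    simpa using key.const_sub 1
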